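/- For $n\ge 3$ let $BP_n$ be the burnt pancake graph: its vertices are the $n!\,2^n$ signed permutations of $\{1,\dots,n\}$, that is, the lists $a_1a_2\cdots a_n$ of nonzero integers such that $|a_1|,\dots,|a_n|$ is a permutation of $1,\dots,n$; two vertices $a_1\cdots a_n$ and $b_1\cdots b_n$ are adjacent if and only if there is an integer $k$ with $1\le k\le n$ such that $a_i=-b_{k+1-i}$ for $1\le i\le k$ and $a_i=b_i$ for $k+1\le i\le n$. A fractional perfect matching of a finite simple graph $G$ is a function $f\colon E(G)\to[0,1]$ such that, for every vertex $v$, the values of $f$ on the edges incident with $v$ sum to $1$. Let $fmp(G)$ be the minimum size of a set $F\subseteq E(G)$ such that $G-F$ has no fractional perfect matching, and let $fsmp(G)$ be the minimum size of a set $F\subseteq V(G)\cup E(G)$ such that $G-F$ has no fractional perfect matching, where $G-F$ arises from $G$ by deleting the vertices in $F$ (with all their incident edges) and the edges in $F$. Then, for every $n\ge 3$, $$fsmp(BP_n)=fmp(BP_n)=n.$$ -/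

import Mathlib

namespace SimpleGraph

variable {V : Type*}

/-- `f` is a fractional matching of the finite graph `G`: each edge gets a number in `[0, 1]`,
and the numbers on the edges incident with any vertex sum to at most `1`.
Only the values of `f` on edges of `G` matter. -/
def IsFractionalMatching [Finite V] (G : SimpleGraph V) (f : Sym2 V → ℝ) : Prop :=
  (∀ e ∈ G.edgeSet, f e ∈ Set.Icc (0 : ℝ) 1) ∧
    ∀ v : V, ∑ᶠ e ∈ G.incidenceSet v, f e ≤ 1

/-- A fractional perfect matching: all the vertex sums are equal to `1`. -/
def IsFractionalPerfectMatching [Finite V] (G : SimpleGraph V) (f : Sym2 V → ℝ) : Prop :=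
  G.IsFractionalMatching f ∧ ∀ v : V, ∑ᶠ e ∈ G.incidenceSet v, f e = 1

def HasFractionalPerfectMatching [Finite V] (G : SimpleGraph V) : Prop :=
  ∃ f : Sym2 V → ℝ, G.IsFractionalPerfectMatching f

/-- The graph `G - (S ∪ F)` obtained by deleting the vertices in `S` (with all edges incident
with them) and the edges in `F`; its vertex set is the complement of `S`. -/
def deleteFaults (G : SimpleGraph V) (S : Finset V) (F : Finset (Sym2 V)) :
    SimpleGraph ((S : Set V)ᶜ : Set V) :=
  (G.deleteEdges (F : Set (Sym2 V))).induce ((S : Set V)ᶜ)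

/-- A set of edges of `G` whose deletion leaves no fractional perfect matching. -/
def IsFMPSet [Finite V] (G : SimpleGraph V) (F : Finset (Sym2 V)) : Prop :=
  (F : Set (Sym2 V)) ⊆ G.edgeSet ∧
    ¬ (G.deleteEdges (F : Set (Sym2 V))).HasFractionalPerfectMatching

/-- A set of vertices (`S`) and edges (`F`) of `G` whose deletion leaves no fractional perfect
matching. -/
def IsFSMPSet [Finite V] (G : SimpleGraph V) (S : Finset V) (F : Finset (Sym2 V)) : Prop :=
  (F : Set (Sym2 V)) ⊆ G.edgeSet ∧ ¬ (G.deleteFaults S F).HasFractionalPerfectMatching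

/-- The fractional matching preclusion number: the minimum size of an FMP set. -/
noncomputable def fmp [Finite V] (G : SimpleGraph V) : ℕ :=
  sInf {k : ℕ | ∃ F : Finset (Sym2 V), G.IsFMPSet F ∧ F.card = k}

/-- The fractional strong matching preclusion number: the minimum size of an FSMP set. -/
noncomputable def fsmp [Finite V] (G : SimpleGraph V) : ℕ :=
  sInf {k : ℕ | ∃ (S : Finset V) (F : Finset (Sym2 V)),
    G.IsFSMPSet S F ∧ S.card + F.card = k}

end SimpleGraph

/-- Signed symbols: `(m, false)` is the symbol `m` and `(m, true)` is the barred symbol `-m`;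
the absolute value is the first component. -/
abbrev SignedSymbol (n : ℕ) : Type := Fin n × Bool

/-- Change of sign. -/
def SignedSymbol.bar {n : ℕ} (x : SignedSymbol n) : SignedSymbol n := (x.1, !x.2)

/-- Signed permutations: lists of `n` signed symbols whose absolute values form a permutation. -/
abbrev SignedPerm (n : ℕ) : Type :=
  {a : Fin n → SignedSymbol n // Function.Bijective fun i => (a i).1}

/-- The burnt pancake graph `BP_n`: two signed permutations are adjacent if, for some
`1 ≤ k ≤ n`, one arises from the other by reversing the prefix of length `k` and changing the
sign of each symbol in it. Positions are counted from `0`, so that for `i + j + 1 = k` the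
positions `i` and `j` are exchanged by the reversal. -/
def burntPancakeGraph (n : ℕ) : SimpleGraph (SignedPerm n) where
  Adj a b := ∃ k : ℕ, 1 ≤ k ∧ k ≤ n ∧
    (∀ i j : Fin n, (i : ℕ) + (j : ℕ) + 1 = k → a.1 i = SignedSymbol.bar (b.1 j)) ∧
    (∀ i : Fin n, k ≤ (i : ℕ) → a.1 i = b.1 i)
  symm := ⟨by
    rintro a b ⟨k, h1, hn, h, h'⟩
    refine ⟨k, h1, hn, fun i j hij => ?_, fun i hi => (h' i hi).symm⟩
    rw [h j i (by omega)]
    simp [SignedSymbol.bar]⟩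
  loopless := ⟨by
    rintro a ⟨k, h1, hn, h, -⟩
    have e := h ⟨0, by omega⟩ ⟨k - 1, by omega⟩ (by simp; omega)
    have e' : (⟨0, by omega⟩ : Fin n) = ⟨k - 1, by omega⟩ := a.2.1 (by simp [e, SignedSymbol.bar])
    rw [← e'] at e
    simpa [SignedSymbol.bar] using congrArg Prod.snd e⟩

/-! Upper bound: deleting the `n` edges at one vertex isolates it. Lower bound for edge faults: the
edges of `BP_n` split into `n` perfect matchings, one for each prefix length, so fewer than `n`
faulty edges leave one of them intact.

For mixed faults the lower bound goes by induction on `n`. Fixing the last symbol cuts `BP_{n+1}`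
into copies of `BP_n`, and the full reversal joins each vertex to a private neighbour in another
copy. If no copy contains all `n` faults, fractional perfect matchings of the copies add up.
Otherwise one fault is restored, the copy is matched fractionally, and the fault is removed again.
The resulting deficits are filled along full-reversal edges. The other copies are fault-free, so an
average of their matchings with one or two vertices left out absorbs the weight sent there
(`isFractionalDegree_of_partition`).

For `n = 3` a relabelling of symbols moves a faulty vertex to the identity; explicit permutations
that move each remaining vertex to a neighbour settle the finitely many cases. The vector of vertex
sums is what gets manipulated: such vectors form a convex cone, so averaging is linear algebra. -/

namespace SimpleGraph

/-! ### The cone of vertex sums of nonnegative edge weightings. -/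

section FractionalDegree

variable {V : Type*} [Fintype V]

/-- `d` is the vector of vertex sums of some nonnegative weighting of the edges of `G`. -/
def IsFractionalDegree (G : SimpleGraph V) (d : V → ℝ) : Prop :=
  ∃ w : V → V → ℝ, (∀ u v, w u v = w v u) ∧ (∀ u v, 0 ≤ w u v) ∧
    (∀ u v, ¬ G.Adj u v → w u v = 0) ∧ ∀ v, ∑ u, w v u = d v

namespace IsFractionalDegree

variable {G H : SimpleGraph V} {d d' : V → ℝ}

theorem mono (h : G ≤ H) (hd : G.IsFractionalDegree d) : H.IsFractionalDegree d := by
  obtain ⟨w, h1, h2, h3, h4⟩ := hd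
  exact ⟨w, h1, h2, fun u v huv => h3 u v fun h' => huv (h h'), h4⟩

theorem zero (G : SimpleGraph V) : G.IsFractionalDegree 0 :=
  ⟨fun _ _ => 0, by simp, by simp, by simp, by simp⟩

theorem add (hd : G.IsFractionalDegree d) (hd' : G.IsFractionalDegree d') :
    G.IsFractionalDegree (d + d') := by
  obtain ⟨w, h1, h2, h3, h4⟩ := hd
  obtain ⟨w', h1', h2', h3', h4'⟩ := hd'
  refine ⟨fun u v => w u v + w' u v, fun u v => by simp only [h1 u v, h1' u v],
    fun u v => add_nonneg (h2 u v) (h2' u v),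
    fun u v h => by simp only [h3 u v h, h3' u v h, add_zero],
    fun v => by rw [Finset.sum_add_distrib, h4, h4', Pi.add_apply]⟩

theorem smul {c : ℝ} (hc : 0 ≤ c) (hd : G.IsFractionalDegree d) :
    G.IsFractionalDegree (c • d) := by
  obtain ⟨w, h1, h2, h3, h4⟩ := hd
  refine ⟨fun u v => c * w u v, fun u v => by simp only [h1 u v],
    fun u v => mul_nonneg hc (h2 u v), fun u v h => by simp only [h3 u v h, mul_zero],
    fun v => by rw [← Finset.mul_sum, h4, Pi.smul_apply, smul_eq_mul]⟩

theorem sum {ι : Type*} (s : Finset ι) {D : ι → V → ℝ}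
    (h : ∀ i ∈ s, G.IsFractionalDegree (D i)) : G.IsFractionalDegree (∑ i ∈ s, D i) :=
  Finset.sum_induction D G.IsFractionalDegree (fun _ _ => add) (zero G) h

/-- Lets an edge be required only where a deficit is actually positive. -/
theorem smul_of_pos {c : ℝ} (hc : 0 ≤ c) (hd : 0 < c → G.IsFractionalDegree d) :
    G.IsFractionalDegree (c • d) := by
  rcases hc.eq_or_lt with rfl | h
  · rw [zero_smul]; exact zero G
  · exact smul hc (hd h)

open Classical in
/-- An edge with weight `1`. -/
theorem of_adj {u v : V} (h : G.Adj u v) :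
    G.IsFractionalDegree (Set.indicator {u} 1 + Set.indicator {v} 1) := by
  have huv : u ≠ v := h.ne
  refine ⟨fun a b => if (a = u ∧ b = v) ∨ (a = v ∧ b = u) then 1 else 0, fun a b => ?_,
    fun a b => ?_, fun a b hab => ?_, fun a => ?_⟩
  · exact if_congr (by tauto) rfl rfl
  · dsimp only; split_ifs <;> norm_num
  · refine if_neg ?_
    rintro (⟨rfl, rfl⟩ | ⟨rfl, rfl⟩)
    exacts [hab h, hab h.symm]
  · by_cases hu : a = u
    · subst hu
      simp [huv]
    · by_cases hv : a = v
      · subst hv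
        simp [hu]
      · simp [hu, hv]

/-- A permutation of `A` that moves each vertex to a neighbour gives weights with all the vertex
sums on `A` equal to `1`. -/
theorem of_bijOn {A : Set V} {σ : V → V} (hσ : Set.BijOn σ A A)
    (hG : ∀ v ∈ A, G.Adj v (σ v)) : G.IsFractionalDegree (Set.indicator A 1) := by
  classical
  -- Weight one half for each pair `v`, `σ v`: a vertex of `A` receives one half as a source and one
  -- half as an image.
  have h : G.IsFractionalDegree (∑ v ∈ A.toFinset,
      (2⁻¹ : ℝ) • (Set.indicator {v} 1 + Set.indicator {σ v} 1)) :=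
    sum _ fun v hv => smul (by norm_num) (of_adj (hG v (by simpa using hv)))
  convert h using 1
  have h1 : ∑ v ∈ A.toFinset, Set.indicator {v} (1 : V → ℝ) = Set.indicator A 1 := by
    ext u
    simp [Finset.sum_apply, Set.indicator]
  have h2 : ∑ v ∈ A.toFinset, Set.indicator {σ v} (1 : V → ℝ) = Set.indicator A 1 := by
    rw [← h1]
    refine Finset.sum_nbij σ ?_ ?_ ?_ (fun _ _ => rfl)
    · intro v hv
      simpa using hσ.mapsTo (by simpa using hv)
    · simpa using hσ.injOn
    · simpa using hσ.surjOn
  rw [← Finset.smul_sum, Finset.sum_add_distrib, h1, h2, ← two_smul ℝ, smul_smul]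
  norm_num

/-- Removing a vertex `v` leaves deficits `x` at the other vertices. -/
theorem exists_deficit (hd : G.IsFractionalDegree d) (v : V) :
    ∃ x : V → ℝ, (∀ u, 0 ≤ x u) ∧ (∀ u, x u ≤ d u) ∧ ∑ u, x u = d v ∧
      G.IsFractionalDegree (d - x - d v • Set.indicator {v} 1) := by
  classical
  obtain ⟨w, h1, h2, h3, h4⟩ := hd
  have hvv : w v v = 0 := h3 v v (G.irrefl)
  refine ⟨w v, h2 v, fun u => ?_, h4 v,
    fun a b => if a = v ∨ b = v then 0 else w a b, fun a b => ?_, fun a b => ?_,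
    fun a b hab => ?_, fun a => ?_⟩
  · rw [← h4 u, h1]
    exact Finset.single_le_sum (fun b _ => h2 u b) (Finset.mem_univ v)
  · simp only [h1 a b, or_comm]
  · dsimp only; split_ifs
    exacts [le_rfl, h2 a b]
  · dsimp only; rw [h3 a b hab, ite_self]
  · by_cases ha : a = v
    · subst ha
      simp [hvv]
    · have : ∀ b, (if a = v ∨ b = v then 0 else w a b) = w a b - if b = v then w a b else 0 := by
        intro b
        by_cases hb : b = v <;> simp [ha, hb]
      simp only [this, Finset.sum_sub_distrib, h4, Finset.sum_ite_eq', Finset.mem_univ, if_true]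
      simp [ha, h1 a v]

/-- Removing an edge leaves the same deficit at both of its ends. -/
theorem exists_deleteEdges_singleton (hd : G.IsFractionalDegree d) (u v : V) :
    ∃ c : ℝ, 0 ≤ c ∧ c ≤ d u ∧ (0 < c → u ≠ v) ∧
      (G.deleteEdges {s(u, v)}).IsFractionalDegree
        (d - c • (Set.indicator {u} 1 + Set.indicator {v} 1)) := by
  classical
  obtain ⟨w, h1, h2, h3, h4⟩ := hd
  refine ⟨w u v, h2 u v, ?_, ?_, fun a b => if s(a, b) = s(u, v) then 0 else w a b,
    fun a b => ?_, fun a b => ?_, fun a b hab => ?_, fun a => ?_⟩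
  · rw [← h4 u]
    exact Finset.single_le_sum (fun b _ => h2 u b) (Finset.mem_univ v)
  · rintro h rfl
    exact h.ne' (h3 u u G.irrefl)
  · simp only [h1 a b, Sym2.eq_swap (a := a)]
  · dsimp only; split_ifs
    exacts [le_rfl, h2 a b]
  · dsimp only; split_ifs with h
    · rfl
    · exact h3 a b fun h' => hab (by simpa [deleteEdges_adj, h'] using h)
  · have : ∀ b, (if s(a, b) = s(u, v) then 0 else w a b) =
        w a b - if s(a, b) = s(u, v) then w u v else 0 := by
      intro b
      split_ifs with h
      · rcases Sym2.eq_iff.1 h with ⟨rfl, rfl⟩ | ⟨rfl, rfl⟩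
        · simp
        · simp [h1 a b]
      · simp
    simp only [this, Finset.sum_sub_distrib, h4]
    rcases eq_or_ne u v with rfl | huv
    · simp [h3 u u G.irrefl]
    · by_cases hu : a = u
      · subst hu
        simp [huv]
      · by_cases hv : a = v
        · subst hv
          simp [hu]
        · simp [hu, hv]

/-- The bound by `1` on single edges is automatic, since the weights are nonnegative and sum to `1`
at each vertex. -/
theorem hasFractionalPerfectMatching (hd : G.IsFractionalDegree 1) :
    G.HasFractionalPerfectMatching := by
  obtain ⟨w, h1, h2, h3, h4⟩ := hd
  have h4' : ∀ v, ∑ u, w v u = 1 := h4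
  have hsum : ∀ v, ∑ᶠ e ∈ G.incidenceSet v, Sym2.lift ⟨w, h1⟩ e = 1 := by
    intro v
    have hb : Set.BijOn (fun u => s(v, u)) (G.neighborSet v) (G.incidenceSet v) := by
      refine ⟨fun u hu => ?_, fun a _ b _ hab => Sym2.congr_right.1 hab, fun e he => ?_⟩
      · exact (G.mem_incidenceSet v u).2 hu
      · obtain ⟨he, hv⟩ := he
        obtain ⟨u, rfl⟩ := Sym2.mem_iff_exists.1 hv
        exact ⟨u, he, rfl⟩
    rw [← finsum_mem_eq_of_bijOn (f := fun u => w v u) _ hb (fun u _ => rfl), ← h4' v,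
      ← finsum_eq_sum_of_fintype]
    refine finsum_congr fun u => ?_
    by_cases hu : G.Adj v u
    · simp [hu]
    · simp [hu, h3 v u hu]
  refine ⟨Sym2.lift ⟨w, h1⟩, ⟨fun e => ?_, fun v => (hsum v).le⟩, hsum⟩
  induction e with
  | h a b =>
    intro _
    refine ⟨h2 a b, ?_⟩
    rw [← h4' a]
    exact Finset.single_le_sum (fun b _ => h2 a b) (Finset.mem_univ b)

/-- A vertex sum `0` on `S` forces all weights at `S` to vanish, so restricting the weighting loses
nothing. -/
theorem induce_compl {S : Finset V} (hd : G.IsFractionalDegree (Set.indicator (S : Set V)ᶜ 1))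
    [Fintype ((S : Set V)ᶜ : Set V)] :
    (G.induce ((S : Set V)ᶜ)).IsFractionalDegree 1 := by
  classical
  obtain ⟨w, h1, h2, h3, h4⟩ := hd
  refine ⟨fun a b => w a b, fun _ _ => h1 _ _, fun _ _ => h2 _ _, fun a b hab => h3 _ _ hab,
    fun a => ?_⟩
  have ha := h4 a
  rw [Set.indicator_of_mem a.2] at ha
  refine Eq.trans (Finset.sum_set_coe (f := fun b => w a b) _) (Eq.trans ?_ ha)
  refine Finset.sum_subset (Finset.subset_univ _) fun b _ hb => ?_
  have hb' := h4 b
  rw [Set.indicator_of_notMem (by simpa using hb),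
    Finset.sum_eq_zero_iff_of_nonneg fun u _ => h2 b u] at hb'
  rw [h1, hb' a (Finset.mem_univ _)]

theorem map {W : Type*} [Fintype W] {H : SimpleGraph W} {A : Set W}
    (hd : H.IsFractionalDegree (Set.indicator A 1)) {f : W → V} (hf : Function.Injective f)
    (hfG : ∀ a b, H.Adj a b → G.Adj (f a) (f b)) :
    G.IsFractionalDegree (Set.indicator (f '' A) 1) := by
  classical
  obtain ⟨w, h1, h2, h3, h4⟩ := hd
  refine ⟨fun u v => ∑ a, ∑ b, if f a = u ∧ f b = v then w a b else 0, fun u v => ?_,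
    fun u v => ?_, fun u v huv => ?_, fun u => ?_⟩
  · dsimp only
    rw [Finset.sum_comm]
    simp only [h1, and_comm]
  · refine Finset.sum_nonneg fun a _ => Finset.sum_nonneg fun b _ => ?_
    split_ifs
    exacts [h2 a b, le_rfl]
  · refine Finset.sum_eq_zero fun a _ => Finset.sum_eq_zero fun b _ => ?_
    split_ifs with h
    · obtain ⟨rfl, rfl⟩ := h
      exact h3 a b fun hab => huv (hfG a b hab)
    · rfl
  · rw [Finset.sum_comm]
    have : ∀ a, ∑ v, ∑ b, (if f a = u ∧ f b = v then w a b else 0) =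
        if f a = u then Set.indicator A 1 a else 0 := by
      intro a
      rw [Finset.sum_comm]
      by_cases h : f a = u
      · simp [h, h4]
      · simp [h]
    simp only [this]
    by_cases hu : u ∈ Set.range f
    · obtain ⟨a, rfl⟩ := hu
      simp [hf.eq_iff, Set.indicator, hf.mem_set_image]
    · have h' : ∀ a, f a ≠ u := fun a ha => hu ⟨a, ha⟩
      simp [h', Set.indicator]

end IsFractionalDegree

theorem not_hasFractionalPerfectMatching_of_isolated {V : Type*} [Finite V] {G : SimpleGraph V}
    {v : V} (h : ∀ u, ¬ G.Adj v u) : ¬ G.HasFractionalPerfectMatching := by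
  rintro ⟨f, -, hf⟩
  have : G.incidenceSet v = ∅ := by
    refine Set.eq_empty_of_forall_notMem fun e he => ?_
    obtain ⟨u, rfl⟩ := Sym2.mem_iff_exists.1 he.2
    exact h u he.1
  simpa [this] using hf v

end FractionalDegree

end SimpleGraph

/-! ### The induction step for partitioned graphs. -/

namespace SimpleGraph

open Classical in
/-- Suppose that the vertices of `G` are partitioned into parts, that each part still has a
fractional perfect matching after at most `N` faults, and that each vertex has a private
neighbour in another part. Then `G` has a fractional perfect matching after `N + 1` faults. -/
theorem isFractionalDegree_of_partition {V C : Type*} [Fintype V] [Fintype C]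
    (G : SimpleGraph V) (p : V → C) (m : V → V) (hm : Function.Injective m)
    (hadj : ∀ v, G.Adj v (m v)) (hpm : ∀ v, p (m v) ≠ p v) {N : ℕ} (hN : 2 ≤ N)
    (ih : ∀ (c : C) (S : Finset V) (F : Finset (Sym2 V)),
      (S.filter fun v => p v = c).card + (F.filter fun e => ∀ v ∈ e, p v = c).card ≤ N →
      (G.deleteEdges F).IsFractionalDegree (Set.indicator ({v | p v = c} \ S) 1))
    (S : Finset V) (F : Finset (Sym2 V)) (hSF : S.card + F.card ≤ N + 1) :
    (G.deleteEdges F).IsFractionalDegree (Set.indicator (S : Set V)ᶜ 1) := by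
  -- If this fails, all `N + 1` faults lie inside a single part `c`; in particular no edge between
  -- parts is faulty.
  by_cases hall : ∀ c, (S.filter fun v => p v = c).card +
      (F.filter fun e => ∀ v ∈ e, p v = c).card ≤ N
  · convert IsFractionalDegree.sum Finset.univ fun c _ => ih c S F (hall c) using 1
    ext v
    simp [Finset.sum_apply, Set.indicator, ite_and]
  push Not at hall
  obtain ⟨c, hc⟩ := hall
  have hS1 := Finset.card_filter_le S fun v => p v = c
  have hF1 := Finset.card_filter_le F fun e => ∀ v ∈ e, p v = c
  have hS : ∀ v ∈ S, p v = c := Finset.filter_card_eq (by omega)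
  have hF : ∀ e ∈ F, ∀ v ∈ e, p v = c := Finset.filter_card_eq (by omega)
  -- The parts other than `c` are fault-free, so up to two vertices can be removed there even if
  -- both lie in one part; this uses `2 ≤ N`.
  have hout : ∀ T : Finset V, T.card ≤ 2 →
      (G.deleteEdges F).IsFractionalDegree (Set.indicator ({v | p v ≠ c} \ T) 1) := by
    intro T hT
    have h : ∀ c' ∈ Finset.univ.erase c, (G.deleteEdges F).IsFractionalDegree
        (Set.indicator ({v | p v = c'} \ T) 1) := by
      intro c' hc'
      refine ih c' T F ?_
      have hF0 : (F.filter fun e => ∀ v ∈ e, p v = c') = ∅ := by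
        refine Finset.filter_eq_empty_iff.2 fun e he h => (Finset.mem_erase.1 hc').1 ?_
        rw [← h _ e.out_fst_mem, hF e he _ e.out_fst_mem]
      have := Finset.card_filter_le T fun v => p v = c'
      rw [hF0, Finset.card_empty]
      omega
    convert IsFractionalDegree.sum _ h using 1
    ext v
    simp [Finset.sum_apply, Set.indicator, ite_and]
  have hcross : ∀ u, p u = c → (G.deleteEdges F).Adj u (m u) := by
    intro u hu
    refine deleteEdges_adj.2 ⟨hadj u, fun h => hpm u ?_⟩
    rw [hu, hF _ h _ (Sym2.mem_mk_right _ _)]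
  rcases S.eq_empty_or_nonempty with rfl | ⟨v, hv⟩
  · obtain ⟨e, he⟩ : F.Nonempty := by
      rw [← Finset.card_pos]
      simp at hc
      omega
    induction e with
    | h u v =>
    have hu : p u = c := hF _ he _ (Sym2.mem_mk_left _ _)
    have hv : p v = c := hF _ he _ (Sym2.mem_mk_right _ _)
    have h1 := ih c ∅ (F.erase s(u, v)) (by
      have := Finset.card_filter_le (F.erase s(u, v)) fun e => ∀ v ∈ e, p v = c
      have := Finset.card_erase_lt_of_mem he
      simp only [Finset.filter_empty, Finset.card_empty] at hSF ⊢
      omega)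
    obtain ⟨x, hx0, hx1, hx2, h2⟩ := h1.exists_deleteEdges_singleton u v
    replace hx1 : x ≤ 1 := by simpa [hu] using hx1
    have h2' : (G.deleteEdges F).IsFractionalDegree _ := h2.mono (by
      rw [deleteEdges_deleteEdges]
      refine deleteEdges_anti fun e he => ?_
      by_cases h : e = s(u, v)
      · simp [h]
      · simpa [h] using he)
    -- The edge carried weight `x`. Both ends regain `x` across parts; outside `c`, the mixture with
    -- weights `1 - x` and `x` leaves exactly `x` free at `m u` and `m v`.
    have h3 := ((((h2'.add (((IsFractionalDegree.of_adj (hcross u hu)).smul hx0))).add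
      ((IsFractionalDegree.of_adj (hcross v hv)).smul hx0))).add
      ((hout ∅ (by simp)).smul (sub_nonneg.2 hx1))).add
      ((hout {m u, m v} Finset.card_le_two).smul hx0)
    -- A member of `F` may be a loop here; then `x = 0`, and `m u ≠ m v` is not available.
    rcases hx0.eq_or_lt with rfl | hx0
    · convert h3 using 1
      ext a
      by_cases ha : p a = c <;> simp [ha]
    · have huv : m u ≠ m v := fun h => hx2 hx0 (hm h)
      convert h3 using 1
      ext a
      by_cases ha : p a = c
      · have h1 : a ≠ m u := by rintro rfl; exact hpm u (ha.trans hu.symm)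
        have h2 : a ≠ m v := by rintro rfl; exact hpm v (ha.trans hv.symm)
        simp [ha, h1, h2]
        ring
      · have h1 : a ≠ u := by rintro rfl; exact ha hu
        have h2 : a ≠ v := by rintro rfl; exact ha hv
        by_cases h3 : a = m u
        · subst h3
          simp [ha, h1, h2, huv]
        · by_cases h4 : a = m v
          · subst h4
            simp [ha, h1, h2, h3]
          · simp [ha, h1, h2, h3, h4]
  · have hvc : p v = c := hS v hv
    have h1 := ih c (S.erase v) F (by
      have := Finset.card_filter_le (S.erase v) fun v => p v = c
      have := Finset.card_erase_lt_of_mem hv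
      omega)
    obtain ⟨x, hx0, hx1, hx2, h2⟩ := h1.exists_deficit v
    replace hx2 : ∑ u, x u = 1 := by simpa [hvc] using hx2
    have hxp : ∀ u, 0 < x u → p u = c := by
      intro u hu
      by_contra h
      have := hx1 u
      simp [h] at this
      linarith
    -- Each deficit `x u` is filled by the edge to `m u`. As the deficits sum to `1`, they serve as
    -- the coefficients of a convex combination of outside matchings that omit `m u`.
    have h3 := (h2.add (IsFractionalDegree.sum Finset.univ fun u _ =>
      IsFractionalDegree.smul_of_pos (hx0 u) fun hu =>
        IsFractionalDegree.of_adj (hcross u (hxp u hu)))).add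
      (IsFractionalDegree.sum Finset.univ fun u _ =>
        (hout {m u} (by simp)).smul (hx0 u))
    convert h3 using 1
    have key : ∀ u, x u • (Set.indicator {u} 1 + Set.indicator {m u} 1 : V → ℝ) +
        x u • Set.indicator ({v | p v ≠ c} \ ({m u} : Finset V)) 1 =
        x u • Set.indicator {u} 1 + x u • Set.indicator {v | p v ≠ c} 1 := by
      intro u
      rcases (hx0 u).eq_or_lt with h | h
      · simp [← h]
      · have hmu : p (m u) ≠ c := by
          rw [← hxp u h]; exact hpm u
        rw [smul_add, add_assoc, ← smul_add (x u) (Set.indicator {m u} 1)]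
        congr 2
        ext a
        by_cases ha : a = m u
        · subst ha
          simp [hmu]
        · simp [ha, Set.indicator]
    rw [add_assoc, ← Finset.sum_add_distrib, Finset.sum_congr rfl fun u _ => key u,
      Finset.sum_add_distrib, ← Finset.sum_smul, hx2, one_smul]
    ext a
    have hsx : (∑ u, x u • (Set.indicator {u} 1 : V → ℝ)) a = x a := by
      simp [Finset.sum_apply, Pi.single_apply]
    simp only [Pi.add_apply, hsx, Pi.sub_apply]
    by_cases ha : p a = c
    · by_cases hav : a = v
      · subst hav
        simp [hvc, hv]
      · by_cases haS : a ∈ S <;> simp [ha, hav, haS]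
    · have h1 : a ≠ v := by rintro rfl; exact ha hvc
      have h2 : a ∉ S := fun h => ha (hS a h)
      simp [ha, h1, h2]

end SimpleGraph

/-! ### Prefix reversals, relabelling and the copies with a fixed last symbol. -/

namespace SignedPerm

variable {n : ℕ}

theorem fst_injective (a : SignedPerm n) : Function.Injective fun i => (a.1 i).1 := a.2.1

/-- Reversal of the positions `0, …, k`. -/
def prefixRev (k i : Fin n) : Fin n :=
  if i ≤ k then ⟨k - i, by omega⟩ else i

theorem prefixRev_le {k i : Fin n} (h : i ≤ k) : prefixRev k i ≤ k := by
  rw [prefixRev, if_pos h]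
  exact Fin.le_def.2 (Nat.sub_le _ _)

theorem prefixRev_involutive (k : Fin n) : Function.Involutive (prefixRev k) := by
  intro i
  by_cases h : i ≤ k
  · rw [prefixRev, if_pos (prefixRev_le h), Fin.ext_iff]
    simp only [prefixRev, h, if_true]
    exact Nat.sub_sub_self h
  · simp [prefixRev, h]

/-- The signed prefix reversal of the positions `0, …, k`. -/
def flip (k : Fin n) (a : SignedPerm n) : SignedPerm n :=
  ⟨fun i => if i ≤ k then SignedSymbol.bar (a.1 (prefixRev k i)) else a.1 i, by
    convert a.2.comp (prefixRev_involutive k).bijective using 1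
    ext i
    by_cases h : i ≤ k <;> simp [h, SignedSymbol.bar, prefixRev]⟩

theorem flip_apply (k : Fin n) (a : SignedPerm n) (i : Fin n) :
    (flip k a).1 i = if i ≤ k then SignedSymbol.bar (a.1 (prefixRev k i)) else a.1 i := rfl

theorem bar_bar (x : SignedSymbol n) : x.bar.bar = x := by simp [SignedSymbol.bar]

theorem flip_involutive (k : Fin n) : Function.Involutive (flip k) := by
  intro a
  refine Subtype.ext (funext fun i => ?_)
  have h2 := prefixRev_involutive k i
  by_cases h : i ≤ k
  · simp [flip_apply, h, prefixRev_le h, h2, bar_bar]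
  · simp [flip_apply, h]

/-- The new first symbol is the barred symbol at position `k`, which determines `k`. -/
theorem flip_index_injective (a : SignedPerm n) : Function.Injective fun k => flip k a := by
  intro k l h
  have h0 := congrArg (fun b : SignedPerm n => b.1 ⟨0, k.pos⟩) h
  have h1 : ∀ k : Fin n, (⟨0, k.pos⟩ : Fin n) ≤ k := fun k => Fin.le_def.2 (Nat.zero_le _)
  simp only [flip_apply, h1, if_true, prefixRev] at h0
  have h2 := congrArg Prod.fst h0
  simpa [SignedSymbol.bar] using a.fst_injective h2

theorem adj_flip (k : Fin n) (a : SignedPerm n) : (burntPancakeGraph n).Adj a (flip k a) := by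
  refine ⟨k + 1, by omega, by omega, fun i j hij => ?_, fun i hi => ?_⟩
  · have hj : j ≤ k := Fin.le_def.2 (by omega)
    have : prefixRev k j = i := by
      simp only [prefixRev, hj, if_true, Fin.ext_iff]
      omega
    rw [flip_apply, if_pos hj, this, bar_bar]
  · rw [flip_apply, if_neg (by rw [Fin.le_def]; omega)]

theorem adj_iff {a b : SignedPerm n} :
    (burntPancakeGraph n).Adj a b ↔ ∃ k, b = flip k a := by
  refine ⟨?_, ?_⟩
  · rintro ⟨k, h1, hn, h, h'⟩
    refine ⟨⟨k - 1, by omega⟩, Subtype.ext (funext fun i => ?_)⟩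
    rw [flip_apply]
    split_ifs with hi
    · rw [Fin.le_def] at hi
      rw [h _ i, bar_bar]
      simp only [prefixRev, Fin.le_def, hi, if_true]
      simp only at hi
      omega
    · exact (h' i (by simp [Fin.le_def] at hi; omega)).symm
  · rintro ⟨k, rfl⟩
    exact adj_flip k a

/-- The prefix length is a proper colouring of the edges, with the colour classes perfect matchings.
-/
theorem flipEdge_eq_iff {a b : SignedPerm n} {k l : Fin n} :
    s(a, flip k a) = s(b, flip l b) ↔ k = l ∧ (a = b ∨ a = flip l b) := by
  constructor
  · intro h
    rcases Sym2.eq_iff.1 h with ⟨rfl, h⟩ | ⟨h1, h2⟩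
    · exact ⟨flip_index_injective a h, Or.inl rfl⟩
    · refine ⟨flip_index_injective a ?_, Or.inr h1⟩
      simp only
      rw [h2, h1, flip_involutive]
  · rintro ⟨rfl, rfl | rfl⟩
    · rfl
    · rw [flip_involutive, Sym2.eq_swap]

/-- The signed permutation `x`, with its symbols renamed by `v`. -/
def relabel (v x : SignedPerm n) : SignedPerm n :=
  ⟨fun i => ((v.1 (x.1 i).1).1, xor (v.1 (x.1 i).1).2 (x.1 i).2), v.2.comp x.2⟩

/-- Relabelling acts on symbols and flips act on positions, apart from a sign change that commutes
with relabelling; this yields vertex transitivity. -/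
theorem relabel_flip (v x : SignedPerm n) (k : Fin n) :
    relabel v (flip k x) = flip k (relabel v x) := by
  refine Subtype.ext (funext fun i => ?_)
  by_cases h : i ≤ k <;> simp [flip_apply, relabel, h, SignedSymbol.bar]

theorem relabel_injective (v : SignedPerm n) : Function.Injective (relabel v) := by
  intro x y h
  refine Subtype.ext (funext fun i => ?_)
  have hi := congrFun (congrArg Subtype.val h) i
  have h0 : ((relabel v x).1 i).1 = ((relabel v y).1 i).1 := congrArg Prod.fst hi
  have h1 : (x.1 i).1 = (y.1 i).1 := v.fst_injective h0
  have h2 := congrArg Prod.snd hi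
  simp only [relabel, h1] at h2
  exact Prod.ext h1 (by simpa using h2)

/-- The signed permutations with the last symbol `c`, as a copy of the signed permutations of one
symbol less. -/
def snoc (c : SignedSymbol (n + 1)) (x : SignedPerm n) : SignedPerm (n + 1) :=
  ⟨Fin.snoc (α := fun _ => SignedSymbol (n + 1))
      (fun i => (c.1.succAbove (x.1 i).1, (x.1 i).2)) c, by
    refine Function.Injective.bijective_of_finite fun i j h => ?_
    induction i using Fin.lastCases with
    | last =>
      induction j using Fin.lastCases with
      | last => rfl
      | cast j => exact absurd h (by simp [(Fin.succAbove_ne _ _).symm])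
    | cast i =>
      induction j using Fin.lastCases with
      | last => exact absurd h (by simp [(Fin.succAbove_ne _ _)])
      | cast j => exact congrArg Fin.castSucc (x.fst_injective (by simpa using h))⟩

theorem snoc_last (c : SignedSymbol (n + 1)) (x : SignedPerm n) :
    (snoc c x).1 (Fin.last n) = c := by simp [snoc]

theorem snoc_castSucc (c : SignedSymbol (n + 1)) (x : SignedPerm n) (i : Fin n) :
    (snoc c x).1 i.castSucc = (c.1.succAbove (x.1 i).1, (x.1 i).2) := by simp [snoc]

theorem snoc_injective (c : SignedSymbol (n + 1)) : Function.Injective (snoc c) := by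
  intro x y h
  refine Subtype.ext (funext fun i => ?_)
  have hi := congrFun (congrArg Subtype.val h) i.castSucc
  simp only [snoc_castSucc, Prod.mk.injEq, Fin.succAbove_right_inj] at hi
  exact Prod.ext hi.1 hi.2

theorem exists_snoc_eq (a : SignedPerm (n + 1)) : ∃ x, snoc (a.1 (Fin.last n)) x = a := by
  have hne : ∀ i : Fin n, (a.1 i.castSucc).1 ≠ (a.1 (Fin.last n)).1 := fun i h =>
    (Fin.castSucc_lt_last i).ne (a.fst_injective h)
  choose f hf using fun i => Fin.exists_succAbove_eq (hne i)
  refine ⟨⟨fun i => (f i, (a.1 i.castSucc).2),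
    Function.Injective.bijective_of_finite fun i j h => ?_⟩, Subtype.ext (funext fun i => ?_)⟩
  · simp only at h
    refine Fin.castSucc_injective n (a.fst_injective ?_)
    simp only
    rw [← hf i, ← hf j, h]
  · induction i using Fin.lastCases with
    | last => rw [snoc_last]
    | cast i => rw [snoc_castSucc]; exact Prod.ext (hf i) rfl

theorem snoc_flip (c : SignedSymbol (n + 1)) (x : SignedPerm n) (k : Fin n) :
    snoc c (flip k x) = flip k.castSucc (snoc c x) := by
  refine Subtype.ext (funext fun i => ?_)
  induction i using Fin.lastCases with
  | last =>
    rw [flip_apply, if_neg (by simp), snoc_last, snoc_last]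
  | cast i =>
    rw [snoc_castSucc, flip_apply, flip_apply]
    by_cases h : i ≤ k
    · have : prefixRev k.castSucc i.castSucc = (prefixRev k i).castSucc := by
        simp [prefixRev, h]
      simp [h, this, snoc_castSucc, SignedSymbol.bar]
    · simp [h, snoc_castSucc]

theorem snoc_adj (c : SignedSymbol (n + 1)) {x y : SignedPerm n}
    (h : (burntPancakeGraph n).Adj x y) :
    (burntPancakeGraph (n + 1)).Adj (snoc c x) (snoc c y) := by
  obtain ⟨k, rfl⟩ := adj_iff.1 h
  rw [snoc_flip]
  exact adj_flip _ _

/-- The full reversal brings the first symbol to the end, with a different absolute value; so it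
leaves the copy. -/
theorem flip_last_last_ne (hn : 1 ≤ n) (a : SignedPerm (n + 1)) :
    (flip (Fin.last n) a).1 (Fin.last n) ≠ a.1 (Fin.last n) := by
  intro h
  rw [flip_apply, if_pos le_rfl] at h
  have h0 : (a.1 (prefixRev (Fin.last n) (Fin.last n))).1 = (a.1 (Fin.last n)).1 := by
    have := congrArg Prod.fst h
    exact this
  have h1 := a.fst_injective h0
  simp [prefixRev, Fin.ext_iff] at h1
  omega

end SignedPerm

/-! ### Edge faults, and fault tolerance from `n` to `n + 1`. -/

open SignedPerm SimpleGraph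

/-- Fewer than `n` edges miss one of the `n` perfect matchings of equal flips. -/
theorem burntPancakeGraph_isFractionalDegree_of_edges {n : ℕ} {F : Finset (Sym2 (SignedPerm n))}
    (hF : F.card < n) : ((burntPancakeGraph n).deleteEdges F).IsFractionalDegree 1 := by
  obtain ⟨k, hk⟩ : ∃ k : Fin n, ∀ a, s(a, flip k a) ∉ F := by
    by_contra! h
    choose a ha using h
    have := Finset.card_le_card_of_injOn (s := Finset.univ) (fun k => s(a k, flip k (a k)))
      (fun k _ => ha k) (fun k _ l _ h => (flipEdge_eq_iff.1 h).1)
    simp at this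
    omega
  rw [← Set.indicator_univ (1 : SignedPerm n → ℝ)]
  exact IsFractionalDegree.of_bijOn (σ := flip k)
    (Set.bijOn_univ.2 (flip_involutive k).bijective)
    fun a _ => deleteEdges_adj.2 ⟨adj_flip k a, hk a⟩

/-- The graph `BP_n` minus at most `n - 1` faults has a fractional perfect matching. -/
def BurntPancakeFaultTolerant (n : ℕ) : Prop :=
  ∀ (S : Finset (SignedPerm n)) (F : Finset (Sym2 (SignedPerm n))), S.card + F.card < n →
    ((burntPancakeGraph n).deleteEdges F).IsFractionalDegree
      (Set.indicator (S : Set (SignedPerm n))ᶜ 1)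

/-- The parts are the fibres of the last symbol, and faults inside a part are pulled back along
`snoc c`. The partition argument needs `n - 1 ≥ 2`, hence the start at `3`. -/
theorem BurntPancakeFaultTolerant.succ {n : ℕ} (hn : 3 ≤ n) (ih : BurntPancakeFaultTolerant n) :
    BurntPancakeFaultTolerant (n + 1) := by
  classical
  intro S F hSF
  refine isFractionalDegree_of_partition (burntPancakeGraph (n + 1))
    (fun a => a.1 (Fin.last n)) (flip (Fin.last n)) (flip_involutive _).injective (adj_flip _)
    (flip_last_last_ne (by omega)) (N := n - 1) (by omega) (fun c S F hc => ?_) S F (by omega)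
  set S' := Finset.univ.filter fun x => snoc c x ∈ S
  set F' := Finset.univ.filter fun e => Sym2.map (snoc c) e ∈ F
  have hS' : S'.card ≤ (S.filter fun a => a.1 (Fin.last n) = c).card :=
    Finset.card_le_card_of_injOn (snoc c)
      (fun x hx => by simpa [S', snoc_last] using hx) (snoc_injective c).injOn
  have hF' : F'.card ≤ (F.filter fun e => ∀ a ∈ e, a.1 (Fin.last n) = c).card :=
    Finset.card_le_card_of_injOn (Sym2.map (snoc c))
      (fun e he => by
        have : Sym2.map (snoc c) e ∈ F := by simpa [F'] using he
        refine Finset.mem_coe.2 (Finset.mem_filter.2 ⟨this, fun a ha => ?_⟩)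
        obtain ⟨x, -, rfl⟩ := Sym2.mem_map.1 ha
        exact snoc_last c x)
      (Sym2.map.injective (snoc_injective c)).injOn
  have hc' : (S.filter fun a => a.1 (Fin.last n) = c).card +
      (F.filter fun e => ∀ a ∈ e, a.1 (Fin.last n) = c).card ≤ n - 1 := by convert hc
  have h := (ih S' F' (by omega)).map (G := (burntPancakeGraph (n + 1)).deleteEdges F)
    (snoc_injective c) fun x y hxy => by
      rw [deleteEdges_adj] at hxy ⊢
      exact ⟨snoc_adj c hxy.1, by simpa [F'] using hxy.2⟩
  convert h using 2
  ext a
  simp only [Set.mem_sdiff, Set.mem_ofPred_eq, Set.mem_image, Set.mem_compl_iff]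
  constructor
  · rintro ⟨rfl, ha⟩
    obtain ⟨x, hx⟩ := exists_snoc_eq a
    exact ⟨x, by simpa [S', hx] using ha, hx⟩
  · rintro ⟨x, hx, rfl⟩
    exact ⟨snoc_last c x, by simpa [S'] using hx⟩

/-! ### The case of three symbols, by computation. -/

/-- Coordinates for the signed permutations of three symbols: a first symbol `f`, a step `1` or
`2` modulo `3`, and the three signs. -/
abbrev ThreeCoord : Type := Fin 3 × Bool × Bool × Bool × Bool

namespace ThreeCoord

def toFun (t : ThreeCoord) (i : Fin 3) : SignedSymbol 3 :=
  (t.1 + (if t.2.1 then 2 else 1) * i, ![t.2.2.1, t.2.2.2.1, t.2.2.2.2] i)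

theorem toFun_fst_injective : ∀ t : ThreeCoord, Function.Injective fun i => (toFun t i).1 := by
  unfold Function.Injective
  decide +kernel

def toSignedPerm (t : ThreeCoord) : SignedPerm 3 :=
  ⟨toFun t, (toFun_fst_injective t).bijective_of_finite⟩

def nbr : Fin 3 → ThreeCoord → ThreeCoord
  | 0, (f, o, x, y, z) => (f, o, !x, y, z)
  | 1, (f, o, x, y, z) => (f + if o then 2 else 1, !o, !y, !x, z)
  | 2, (f, o, x, y, z) => (f + if o then 1 else 2, !o, !z, !y, !x)

theorem toSignedPerm_nbr (k : Fin 3) (t : ThreeCoord) :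
    toSignedPerm (nbr k t) = flip k (toSignedPerm t) := by
  have h : ∀ (k : Fin 3) (t : ThreeCoord) (i : Fin 3), toFun (nbr k t) i =
      if i ≤ k then SignedSymbol.bar (toFun t (prefixRev k i)) else toFun t i := by
    decide +kernel
  exact Subtype.ext (funext (h k t))

theorem toSignedPerm_injective : Function.Injective toSignedPerm := by
  have h : ∀ s t : ThreeCoord, (∀ i, toFun s i = toFun t i) → s = t := by
    decide +kernel
  exact fun s t hst => h s t (congrFun (congrArg Subtype.val hst))

theorem toSignedPerm_surjective : Function.Surjective toSignedPerm := by
  intro a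
  have h : ∀ p q r : Fin 3, p ≠ q → p ≠ r → q ≠ r →
      ∃ o : Bool, q = p + (if o then 2 else 1) ∧ r = p + (if o then 2 else 1) * 2 := by
    decide
  obtain ⟨o, h1, h2⟩ := h (a.1 0).1 (a.1 1).1 (a.1 2).1
    (fun h => absurd (a.fst_injective h) (by decide))
    (fun h => absurd (a.fst_injective h) (by decide))
    (fun h => absurd (a.fst_injective h) (by decide))
  refine ⟨((a.1 0).1, o, (a.1 0).2, (a.1 1).2, (a.1 2).2), Subtype.ext (funext fun i => ?_)⟩
  fin_cases i
  · simp [toSignedPerm, toFun]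
  · simp [toSignedPerm, toFun, ← h1]
  · exact Prod.ext h2.symm rfl

theorem nbr_nbr (k : Fin 3) (t : ThreeCoord) : nbr k (nbr k t) = t :=
  toSignedPerm_injective (by simp only [toSignedPerm_nbr, (flip_involutive k) _])

/-- The identity signed permutation. -/
def base : ThreeCoord := (0, false, false, false, false)

/-- The relabelling of the coordinates that sends `base` to `v`. -/
def place (v : SignedPerm 3) (t : ThreeCoord) : SignedPerm 3 := relabel v (toSignedPerm t)

theorem place_bijective (v : SignedPerm 3) : Function.Bijective (place v) :=
  (Finite.injective_iff_bijective.1 (relabel_injective v)).comp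
    ⟨toSignedPerm_injective, toSignedPerm_surjective⟩

theorem place_base (v : SignedPerm 3) : place v base = v := by
  refine Subtype.ext (funext fun i => ?_)
  fin_cases i <;> simp [place, relabel, toSignedPerm, toFun, base]

theorem place_nbr (v : SignedPerm 3) (k : Fin 3) (t : ThreeCoord) :
    place v (nbr k t) = flip k (place v t) := by
  rw [place, place, toSignedPerm_nbr, relabel_flip]

/-- The place of a coordinate vector in their lexicographic order. -/
def code : ThreeCoord → ℕ
  | (f, o, x, y, z) => 16 * f.val + 8 * o.toNat + 4 * x.toNat + 2 * y.toNat + z.toNat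

/-- The digit of `N` in base `3` with the place `code t`. -/
def digit (N : ℕ) (t : ThreeCoord) : Fin 3 := Fin.ofNat 3 (N / 3 ^ code t)

/-- The digits of `N` choose for each vertex other than `base` and `w` a flip, and these flips
permute the vertices other than `base` and `w`. -/
def IsCertificate (w : ThreeCoord) (N : ℕ) : Prop :=
  (∀ t, t ≠ base → t ≠ w → nbr (digit N t) t ≠ base ∧ nbr (digit N t) t ≠ w) ∧
  ∀ t k l, k < l → digit N (nbr k t) = k → digit N (nbr l t) = l →
    nbr k t = base ∨ nbr k t = w ∨ nbr l t = base ∨ nbr l t = w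

set_option synthInstance.maxSize 1000 in
instance (w : ThreeCoord) (N : ℕ) : Decidable (IsCertificate w N) :=
  inferInstanceAs (Decidable (_ ∧ _))

/-- Equal flips are injective, so a collision needs two different flips. The certificate excludes
these by ranging over the common image, which is cheaper to check than all pairs of sources. -/
theorem IsCertificate.bijOn {w : ThreeCoord} {N : ℕ} (h : IsCertificate w N) :
    Set.BijOn (fun t => nbr (digit N t) t) {base, w}ᶜ {base, w}ᶜ := by
  have hm : Set.MapsTo (fun t => nbr (digit N t) t) {base, w}ᶜ {base, w}ᶜ := by
    intro t ht
    simp only [Set.mem_compl_iff, Set.mem_insert_iff, Set.mem_singleton_iff, not_or] at ht ⊢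
    exact h.1 t ht.1 ht.2
  have hne : ∀ s ∈ ({base, w} : Set ThreeCoord)ᶜ, ∀ t ∈ ({base, w} : Set ThreeCoord)ᶜ,
      nbr (digit N s) s = nbr (digit N t) t → ¬ digit N s < digit N t := by
    intro s hs t ht hst hlt
    simp only [Set.mem_compl_iff, Set.mem_insert_iff, Set.mem_singleton_iff, not_or] at hs ht
    have h2 : nbr (digit N t) (nbr (digit N s) s) = t := by rw [hst, nbr_nbr]
    have := h.2 (nbr (digit N s) s) _ _ hlt (by rw [nbr_nbr]) (by rw [h2])
    rw [nbr_nbr, h2] at this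
    tauto
  have hi : Set.InjOn (fun t => nbr (digit N t) t) {base, w}ᶜ := by
    intro s hs t ht hst
    have heq : digit N s = digit N t :=
      le_antisymm (not_lt.1 (hne t ht s hs hst.symm)) (not_lt.1 (hne s hs t ht hst))
    simp only [heq] at hst
    rw [← nbr_nbr (digit N t) s, hst, nbr_nbr]
  exact ((Set.toFinite _).injOn_iff_bijOn_of_mapsTo hm).1 hi

theorem IsCertificate.isFractionalDegree {w : ThreeCoord} {N : ℕ} (h : IsCertificate w N)
    (v : SignedPerm 3) {F : Finset (Sym2 (SignedPerm 3))}
    (hF : ∀ t, t ≠ base → t ≠ w → s(place v t, flip (digit N t) (place v t)) ∉ F) :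
    ((burntPancakeGraph 3).deleteEdges F).IsFractionalDegree
      (Set.indicator {v, place v w}ᶜ 1) := by
  have h1 : (((burntPancakeGraph 3).deleteEdges F).comap (place v)).IsFractionalDegree
      (Set.indicator {base, w}ᶜ 1) := by
    refine IsFractionalDegree.of_bijOn h.bijOn fun t ht => ?_
    simp only [Set.mem_compl_iff, Set.mem_insert_iff, Set.mem_singleton_iff, not_or] at ht
    rw [comap_adj, place_nbr]
    exact deleteEdges_adj.2 ⟨adj_flip _ _, hF t ht.1 ht.2⟩
  have h2 := h1.map (G := (burntPancakeGraph 3).deleteEdges F)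
    (place_bijective v).injective fun a b hab => hab
  rwa [Set.image_compl_eq (place_bijective v), Set.image_pair, place_base] at h2

/-- Certificates for the deletion of `base` and a further vertex, in the order of the codes. -/
def pairCertificates : List ℕ :=
  [17755951455729059076309, 35931232468062431219268, 5064455050893931350384,
   144872168294174944086, 15892786320020055167076, 32620503328246718217582,
   48128971989143751567954, 42618206793188826067008, 5970273036671606700414,
   49641918485380061763444, 5370083909377735919880, 51310787311065753607122,
   21860278809653181248544, 22699816178480392234518, 50472323646120442942842,
   36046177434466624107516, 32547158051238377921370, 4163660424497665849440,
   50551017895974861055344, 42058117302467833093758, 40965843163078442195508,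
   45013214493055633847526, 39280068191518746471006, 20232968032126753989300,
   40801847241770765956158, 15247602726857705090556, 24175185081735831723504,
   52270683891669370394190, 50369991021634100878800, 5941911038886791122122,
   28562670716150250877998, 42306007618374402111324, 46606836989712548331030,
   20552728475205551683692, 28399359516029076709056, 51484596905734364777466,
   36591892360652999820456, 24509894806029850652298, 30966009487322467677798,
   6968957979100316807340, 48511786881417899689878, 42147924351134610410700,
   52282918798768388562360, 40424671361265279086730, 14911329266170733099808,
   19033386429101550118554, 31335123428699423752566, 4759475045858072687820]

theorem isCertificate_pair : ∀ w : ThreeCoord,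
    IsCertificate w (pairCertificates.getD (code w) 0) := by
  decide +kernel

/-- Certificates for the deletion of `base`, without a common edge. -/
def singleCertificate : Fin 3 → ℕ :=
  ![17755951455729059076309, 39987828988476386627481, 53118476745610060366053]

theorem isCertificate_single : ∀ i, IsCertificate base (singleCertificate i) := by
  decide +kernel

set_option synthInstance.maxSize 1000 in
theorem exists_singleCertificate_avoiding : ∀ (t : ThreeCoord) (k : Fin 3), ∃ i,
    (t ≠ base → digit (singleCertificate i) t ≠ k) ∧
    (nbr k t ≠ base → digit (singleCertificate i) (nbr k t) ≠ k) := by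
  decide +kernel

/-- If every certificate used `e`, then `e` would be the flip edge chosen by certificate `0`; but
each flip edge is avoided, from both of its ends, by some certificate. -/
theorem exists_singleCertificate (v : SignedPerm 3) (e : Sym2 (SignedPerm 3)) :
    ∃ i, ∀ t, t ≠ base →
      s(place v t, flip (digit (singleCertificate i) t) (place v t)) ≠ e := by
  by_contra! h
  choose t ht hte using h
  obtain ⟨i, h1, h2⟩ := exists_singleCertificate_avoiding (t 0) (digit (singleCertificate 0) (t 0))
  obtain ⟨h3, h4⟩ := flipEdge_eq_iff.1 ((hte i).trans (hte 0).symm)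
  rw [← place_nbr, (place_bijective v).injective.eq_iff,
    (place_bijective v).injective.eq_iff] at h4
  rcases h4 with h4 | h4
  · exact h1 (ht 0) (h4 ▸ h3)
  · exact h2 (h4 ▸ ht i) (h4 ▸ h3)

end ThreeCoord

open ThreeCoord in
theorem burntPancakeFaultTolerant_three : BurntPancakeFaultTolerant 3 := by
  intro S F hSF
  rcases S.eq_empty_or_nonempty with rfl | ⟨v, hv⟩
  · simpa using burntPancakeGraph_isFractionalDegree_of_edges (n := 3) (F := F) (by simpa using hSF)
  have hS0 : 0 < S.card := Finset.card_pos.2 ⟨v, hv⟩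
  rcases F.eq_empty_or_nonempty with rfl | ⟨e, he⟩
  · obtain ⟨w, rfl⟩ : ∃ w, S = {v, w} := by
      classical
      have h1 := Finset.card_erase_of_mem hv
      have h2 : (S.erase v).card ≤ 1 := by simp at hSF; omega
      rcases (S.erase v).eq_empty_or_nonempty with h | ⟨w, hw⟩
      -- A single faulty vertex is the degenerate pair `w = v`, covered by the certificate with `w =
      -- base`.
      · exact ⟨v, by rw [← Finset.insert_erase hv, h]; simp⟩
      · refine ⟨w, ?_⟩
        have h3 : S.erase v = {w} := Finset.eq_singleton_iff_unique_mem.2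
          ⟨hw, fun x hx => Finset.card_le_one.1 h2 x hx w hw⟩
        rw [← Finset.insert_erase hv, h3]
    obtain ⟨t, rfl⟩ := (place_bijective v).surjective w
    simpa using (isCertificate_pair t).isFractionalDegree v (F := ∅) (by simp)
  · have hF0 : 0 < F.card := Finset.card_pos.2 ⟨e, he⟩
    obtain rfl : S = {v} := Finset.eq_singleton_iff_unique_mem.2
      ⟨hv, fun x hx => Finset.card_le_one.1 (by omega) x hx v hv⟩
    obtain rfl : F = {e} := Finset.eq_singleton_iff_unique_mem.2
      ⟨he, fun x hx => Finset.card_le_one.1 (by omega) x hx e he⟩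
    obtain ⟨i, hi⟩ := exists_singleCertificate v e
    simpa [place_base] using (isCertificate_single i).isFractionalDegree v (F := {e})
      fun t ht _ => by simpa using hi t ht

/-! ### Conclusion: both bounds. -/

theorem burntPancakeFaultTolerant {n : ℕ} (hn : 3 ≤ n) : BurntPancakeFaultTolerant n := by
  induction n, hn using Nat.le_induction with
  | base => exact burntPancakeFaultTolerant_three
  | succ n hn ih => exact ih.succ hn

/-- Deleting all the edges at a vertex isolates it. -/
theorem exists_isolating_edges (n : ℕ) (a : SignedPerm n) :
    ∃ F : Finset (Sym2 (SignedPerm n)), (F : Set (Sym2 (SignedPerm n))) ⊆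
      (burntPancakeGraph n).edgeSet ∧ F.card ≤ n ∧
      ∀ b, ¬ ((burntPancakeGraph n).deleteEdges F).Adj a b := by
  classical
  -- At most `n` edges suffices; the lower bound supplies equality.
  refine ⟨Finset.univ.image fun k => s(a, flip k a), ?_, ?_, fun b hb => ?_⟩
  · intro e he
    simp only [Finset.coe_image, Finset.coe_univ, Set.image_univ, Set.mem_range] at he
    obtain ⟨k, rfl⟩ := he
    exact adj_flip k a
  · exact Finset.card_image_le.trans (by simp)
  · obtain ⟨h1, h2⟩ := deleteEdges_adj.1 hb
    obtain ⟨k, rfl⟩ := adj_iff.1 h1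
    exact h2 (Finset.mem_coe.2 (Finset.mem_image_of_mem _ (Finset.mem_univ k)))

theorem theorem4p41 (n : ℕ) (hn : 3 ≤ n) :
    (burntPancakeGraph n).fsmp = n ∧ (burntPancakeGraph n).fmp = n := by
  classical
  obtain ⟨F, hFE, hFn, hF⟩ := exists_isolating_edges n ⟨fun i => (i, false), Function.bijective_id⟩
  have hmp : (burntPancakeGraph n).IsFMPSet F :=
    ⟨hFE, not_hasFractionalPerfectMatching_of_isolated hF⟩
  have hsmp : (burntPancakeGraph n).IsFSMPSet ∅ F :=
    ⟨hFE, not_hasFractionalPerfectMatching_of_isolated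
      (v := ⟨⟨fun i => (i, false), Function.bijective_id⟩, by simp⟩) fun b hb => hF b hb⟩
  constructor
  · refine le_antisymm (le_trans (Nat.sInf_le ⟨∅, F, hsmp, rfl⟩) (by simpa using hFn))
      (le_csInf ⟨_, ∅, F, hsmp, rfl⟩ ?_)
    rintro k ⟨S, F', ⟨-, h⟩, rfl⟩
    by_contra! hlt
    exact h (burntPancakeFaultTolerant hn S F' hlt).induce_compl.hasFractionalPerfectMatching
  · refine le_antisymm (le_trans (Nat.sInf_le ⟨F, hmp, rfl⟩) hFn)
      (le_csInf ⟨_, F, hmp, rfl⟩ ?_)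
    rintro k ⟨F', ⟨-, h⟩, rfl⟩
    by_contra! hlt
    exact h (burntPancakeGraph_isFractionalDegree_of_edges hlt).hasFractionalPerfectMatching
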